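/- **Setting.** Let $\mathcal C$ be the category of cubes: objects are finite sets $I, J, \dots$ of names from a fixed countably infinite set, and a morphism $I \to J$ is a function $J \to \mathsf{dM}(I)$, where $\mathsf{dM}(I)$ is the free De Morgan algebra on $I$ (composition is Kleisli composition). Let $\omega$ be the poset of natural numbers. We work in the presheaf topos $\widehat{\mathcal C\times\omega}$ and its internal extensional dependent type theory: contexts $\Gamma$ are presheaves on $\mathcal C\times\omega$, types $\Gamma\vdash A$ are presheaves on the category of elements of $\Gamma$, terms are global sections, and $\Gamma, x:A$ is the usual context extension. The interval is $\mathbb I(I,n)=\mathsf{dM}(I)$, and $\mathbb F$ is the image of $(\cdot=1):\mathbb I\to\Omega$, where $\Omega$ is the subobject classifier. For $\varphi:\mathbb F$ put $[\varphi]=\mathrm{Id}_{\mathbb F}(\varphi,\top)$ and $B^{\varphi}=\Pi(p:[\varphi]).B$, and for $u : A$ defined on $[\varphi]$ put $A[\varphi\mapsto u]=\Sigma(a:A).(\mathrm{Id}_A(a,u))^{\varphi}$. **Compositions.** For $\Gamma\vdash A$, the closed type of compositions is $$\Phi(\Gamma;A)=\Pi(\gamma:\mathbb I\to\Gamma)(\varphi:\mathbb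 F)\bigl(u:\Pi(i:\mathbb I).(A(\gamma(i)))^{\varphi}\bigr).\;A(\gamma(0))[\varphi\mapsto u(0)]\to A(\gamma(1))[\varphi\mapsto u(1)].$$ A composition structure on $A$ in context $\Gamma$ is a closed term of $\Phi(\Gamma;A)$. **Later types.** For a presheaf $X$, $(\triangleright X)(I,0)=\{\star\}$ and $(\triangleright X)(I,n+1)=X(I,n)$; let $\mathrm{next}:X\to\triangleright X$ be the map given by restriction. For a type $A$ over $\Delta$, let $\triangleright A$ be the type over $\triangleright\Delta$ with fibre $\{\star\}$ at $(I,0)$ and fibre $A(I,n)(x)$ over $x\in(\triangleright\Delta)(I,n+1)=\Delta(I,n)$. Delayed substitutions $\xi:\Gamma\rightharpoonup\Gamma'$, their interpretations $[\![\xi]\!]:\Gamma\to\triangleright(\Gamma,\Gamma')$, and the types $\Gamma\vdash\triangleright\xi.A:=(\triangleright A)$ pulled back along $[\![\xi]\!]$, for $\Gamma,\Gamma'\vdash A$, are generated as follows. The empty delayed substitution $\Gamma\rightharpoonup\cdot$ is interpreted by $\mathrm{next}$. If $\xi:\Gamma\rightharpoonup\Gamma'$, $\Gamma,\Gamma'\vdash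 B$ and $\Gamma\vdash t:\triangleright\xi.B$, then $\xi[x\leftarrow t]:\Gamma\rightharpoonup(\Gamma',x:B)$ is interpreted by the pairing $([\![\xi]\!],t):\Gamma\to\triangleright(\Gamma,\Gamma',x:B)$. **Lemma.** Let $\xi:\Gamma\rightharpoonup\Gamma'$ be a delayed substitution and $\Gamma,\Gamma'\vdash A$ a type. If there is a closed term $\mathbf c_A$ of type $\Phi(\Gamma,\Gamma';A)$, then there is a closed term $\mathbf c$ of type $\Phi(\Gamma;\triangleright\xi.A)$. -/

import Mathlib

open CategoryTheory

universe u

namespace GCTT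

/-! ### De Morgan algebras and the free De Morgan algebra on a type of names -/

/-- A De Morgan algebra: a bounded distributive lattice with an involution that satisfies
the De Morgan laws. -/
class DeMorganAlgebra (M : Type u) extends DistribLattice M, BoundedOrder M, Compl M where
  neg_neg' : ∀ a : M, aᶜᶜ = a
  neg_inf' : ∀ a b : M, (a ⊓ b)ᶜ = aᶜ ⊔ bᶜ
  neg_sup' : ∀ a b : M, (a ⊔ b)ᶜ = aᶜ ⊓ bᶜ

/-- Expressions `r, s ::= 0 | 1 | i | 1 - r | r ∧ s | r ∨ s` with names `i` in `α`. -/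
inductive DMTerm (α : Type) : Type
  | var : α → DMTerm α
  | zero : DMTerm α
  | one : DMTerm α
  | neg : DMTerm α → DMTerm α
  | inf : DMTerm α → DMTerm α → DMTerm α
  | sup : DMTerm α → DMTerm α → DMTerm α

namespace DMTerm

/-- The congruence on expressions generated by the axioms of De Morgan algebras. -/
inductive Rel {α : Type} : DMTerm α → DMTerm α → Prop
  | refl (a) : Rel a a
  | symm {a b} : Rel a b → Rel b a
  | trans {a b c} : Rel a b → Rel b c → Rel a c
  | neg_congr {a b} : Rel a b → Rel (neg a) (neg b)
  | inf_congr {a a' b b'} : Rel a a' → Rel b b' → Rel (inf a b) (inf a' b')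
  | sup_congr {a a' b b'} : Rel a a' → Rel b b' → Rel (sup a b) (sup a' b')
  | inf_comm (a b) : Rel (inf a b) (inf b a)
  | sup_comm (a b) : Rel (sup a b) (sup b a)
  | inf_assoc (a b c) : Rel (inf (inf a b) c) (inf a (inf b c))
  | sup_assoc (a b c) : Rel (sup (sup a b) c) (sup a (sup b c))
  | inf_sup_self (a b) : Rel (inf a (sup a b)) a
  | sup_inf_self (a b) : Rel (sup a (inf a b)) a
  | inf_sup (a b c) : Rel (inf a (sup b c)) (sup (inf a b) (inf a c))
  | zero_sup (a) : Rel (sup zero a) a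
  | one_inf (a) : Rel (inf one a) a
  | neg_neg (a) : Rel (neg (neg a)) a
  | neg_inf (a b) : Rel (neg (inf a b)) (sup (neg a) (neg b))
  | neg_sup (a b) : Rel (neg (sup a b)) (inf (neg a) (neg b))

instance setoid (α : Type) : Setoid (DMTerm α) where
  r := Rel
  iseqv := ⟨Rel.refl, Rel.symm, Rel.trans⟩

/-- Evaluation of an expression in a De Morgan algebra. -/
def eval {α : Type} {M : Type u} [DeMorganAlgebra M] (f : α → M) : DMTerm α → M
  | var i => f i
  | zero => ⊥
  | one => ⊤
  | neg a => (eval f a)ᶜ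
  | inf a b => eval f a ⊓ eval f b
  | sup a b => eval f a ⊔ eval f b

theorem eval_rel {α : Type} {M : Type u} [DeMorganAlgebra M] (f : α → M) {a b : DMTerm α}
    (h : Rel a b) : eval f a = eval f b := by
  induction h with
  | refl => rfl
  | symm _ ih => exact ih.symm
  | trans _ _ ih1 ih2 => exact ih1.trans ih2
  | neg_congr _ ih => simp only [eval, ih]
  | inf_congr _ _ ih1 ih2 => simp only [eval, ih1, ih2]
  | sup_congr _ _ ih1 ih2 => simp only [eval, ih1, ih2]
  | inf_comm a b => exact _root_.inf_comm _ _
  | sup_comm a b => exact _root_.sup_comm _ _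
  | inf_assoc a b c => exact _root_.inf_assoc _ _ _
  | sup_assoc a b c => exact _root_.sup_assoc _ _ _
  | inf_sup_self a b => exact _root_.inf_sup_self
  | sup_inf_self a b => exact _root_.sup_inf_self
  | inf_sup a b c => exact inf_sup_left _ _ _
  | zero_sup a => exact bot_sup_eq _
  | one_inf a => exact top_inf_eq _
  | neg_neg a => exact DeMorganAlgebra.neg_neg' _
  | neg_inf a b => exact DeMorganAlgebra.neg_inf' _ _
  | neg_sup a b => exact DeMorganAlgebra.neg_sup' _ _

end DMTerm

/-- The free De Morgan algebra on `α`. -/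
def FreeDM (α : Type) : Type := Quotient (DMTerm.setoid α)

namespace FreeDM

variable {α : Type}

instance : Max (FreeDM α) :=
  ⟨Quotient.map₂ DMTerm.sup fun _ _ h _ _ h' => DMTerm.Rel.sup_congr h h'⟩

instance : Min (FreeDM α) :=
  ⟨Quotient.map₂ DMTerm.inf fun _ _ h _ _ h' => DMTerm.Rel.inf_congr h h'⟩

instance : Compl (FreeDM α) :=
  ⟨Quotient.map DMTerm.neg fun _ _ h => DMTerm.Rel.neg_congr h⟩

instance : Lattice (FreeDM α) :=
  Lattice.mk'
    (by rintro ⟨a⟩ ⟨b⟩; exact Quotient.sound (DMTerm.Rel.sup_comm a b))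
    (by rintro ⟨a⟩ ⟨b⟩ ⟨c⟩; exact Quotient.sound (DMTerm.Rel.sup_assoc a b c))
    (by rintro ⟨a⟩ ⟨b⟩; exact Quotient.sound (DMTerm.Rel.inf_comm a b))
    (by rintro ⟨a⟩ ⟨b⟩ ⟨c⟩; exact Quotient.sound (DMTerm.Rel.inf_assoc a b c))
    (by rintro ⟨a⟩ ⟨b⟩; exact Quotient.sound (DMTerm.Rel.sup_inf_self a b))
    (by rintro ⟨a⟩ ⟨b⟩; exact Quotient.sound (DMTerm.Rel.inf_sup_self a b))

instance : DistribLattice (FreeDM α) :=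
  DistribLattice.ofInfSupLe
    (by rintro ⟨a⟩ ⟨b⟩ ⟨c⟩; exact le_of_eq (Quotient.sound (DMTerm.Rel.inf_sup a b c)))

instance : BoundedOrder (FreeDM α) where
  top := Quotient.mk _ DMTerm.one
  bot := Quotient.mk _ DMTerm.zero
  le_top := by
    rintro ⟨a⟩
    exact inf_eq_right.mp (Quotient.sound (DMTerm.Rel.one_inf a))
  bot_le := by
    rintro ⟨a⟩
    exact sup_eq_right.mp (Quotient.sound (DMTerm.Rel.zero_sup a))

instance : DeMorganAlgebra (FreeDM α) where
  neg_neg' := by rintro ⟨a⟩; exact Quotient.sound (DMTerm.Rel.neg_neg a)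
  neg_inf' := by rintro ⟨a⟩ ⟨b⟩; exact Quotient.sound (DMTerm.Rel.neg_inf a b)
  neg_sup' := by rintro ⟨a⟩ ⟨b⟩; exact Quotient.sound (DMTerm.Rel.neg_sup a b)

/-- The generator given by a name. -/
def of (i : α) : FreeDM α := Quotient.mk _ (DMTerm.var i)

/-- The homomorphism of De Morgan algebras extending `f`. -/
def lift {M : Type u} [DeMorganAlgebra M] (f : α → M) : FreeDM α → M :=
  Quotient.lift (DMTerm.eval f) fun _ _ h => DMTerm.eval_rel f h

theorem lift_of {M : Type u} [DeMorganAlgebra M] (f : α → M) (i : α) : lift f (of i) = f i := rfl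

theorem lift_top {M : Type u} [DeMorganAlgebra M] (f : α → M) : lift f ⊤ = ⊤ := rfl

theorem lift_bot {M : Type u} [DeMorganAlgebra M] (f : α → M) : lift f ⊥ = ⊥ := rfl

theorem lift_of_self (r : FreeDM α) : lift of r = r := by
  obtain ⟨r⟩ := r
  change DMTerm.eval of r = Quotient.mk _ r
  induction r with
  | var i => rfl
  | zero => rfl
  | one => rfl
  | neg a ih => rw [DMTerm.eval, ih]; rfl
  | inf a b ih1 ih2 => rw [DMTerm.eval, ih1, ih2]; rfl
  | sup a b ih1 ih2 => rw [DMTerm.eval, ih1, ih2]; rfl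

theorem lift_lift {β : Type} {M : Type u} [DeMorganAlgebra M] (f : β → M) (g : α → FreeDM β)
    (r : FreeDM α) : lift f (lift g r) = lift (fun i => lift f (g i)) r := by
  obtain ⟨r⟩ := r
  change lift f (DMTerm.eval g r) = DMTerm.eval (fun i => lift f (g i)) r
  have hneg : ∀ a : FreeDM β, lift f aᶜ = (lift f a)ᶜ := by rintro ⟨a⟩; rfl
  have hinf : ∀ a b : FreeDM β, lift f (a ⊓ b) = lift f a ⊓ lift f b := by
    rintro ⟨a⟩ ⟨b⟩; rfl
  have hsup : ∀ a b : FreeDM β, lift f (a ⊔ b) = lift f a ⊔ lift f b := by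
    rintro ⟨a⟩ ⟨b⟩; rfl
  induction r with
  | var i => rfl
  | zero => rfl
  | one => rfl
  | neg a ih => exact (hneg _).trans (congrArg _ ih)
  | inf a b ih1 ih2 => exact (hinf _ _).trans (congrArg₂ _ ih1 ih2)
  | sup a b ih1 ih2 => exact (hsup _ _).trans (congrArg₂ _ ih1 ih2)

end FreeDM

/-! ### The category of cubes and the site -/

/-- Objects of the category of cubes: finite sets of names, drawn from the countably
infinite set `ℕ`. -/
structure Cube : Type where
  names : Finset ℕ

/-- A morphism `I ⟶ J` is a function `J → dM(I)`; composition is Kleisli composition. -/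
instance : SmallCategory Cube where
  Hom I J := J.names → FreeDM I.names
  id _ := FreeDM.of
  comp f g := fun k => FreeDM.lift f (g k)
  id_comp g := funext fun k => FreeDM.lift_of_self (g k)
  comp_id _ := rfl
  assoc f g h := funext fun k => (FreeDM.lift_lift f g (h k)).symm

/-- The site `𝒞 × ω`, where `ω` is the poset of natural numbers. -/
abbrev CubeOmega : Type := Cube × ℕ

/-! ### Presheaf categories as models of dependent type theory -/

/-- Contexts are presheaves. -/
abbrev Ctx (S : Type) [SmallCategory S] := Sᵒᵖ ⥤ Type u

section CwF

variable {S : Type} [SmallCategory S]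

/-- Types in context `Γ` are presheaves on the category of elements of `Γ`. (`Γ.Elements` has
as objects pairs of `c : Sᵒᵖ` and `x : Γ.obj c`, and its arrows are those of `Sᵒᵖ`, so presheaves
are covariant functors on it.) -/
abbrev Ty (Γ : Ctx.{u} S) := Γ.Elements ⥤ Type u

/-- Terms of a type are its global sections. -/
abbrev Tm {Γ : Ctx.{u} S} (A : Ty Γ) : Type u := A.sections

/-- Substitution in types. -/
abbrev Ty.subst {Γ Δ : Ctx.{u} S} (A : Ty Δ) (σ : Γ ⟶ Δ) : Ty Γ := CategoryOfElements.map σ ⋙ A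

/-- Substitution in terms. -/
def Tm.subst {Γ Δ : Ctx.{u} S} {A : Ty Δ} (t : Tm A) (σ : Γ ⟶ Δ) : Tm (A.subst σ) :=
  ⟨fun j => t.1 ((CategoryOfElements.map σ).obj j), fun f => t.2 ((CategoryOfElements.map σ).map f)⟩

theorem Ty.pair_map_eq {Γ : Ctx.{u} S} (A : Ty Γ) {c d : Sᵒᵖ} (x : Γ.obj c) (y : Γ.obj d)
    (f : c ⟶ d) (h : Γ.map f x = y) (a : A.obj ⟨c, x⟩) :
    (⟨Γ.map f x, A.map (X := ⟨c, x⟩) (Y := ⟨d, Γ.map f x⟩) ⟨f, rfl⟩ a⟩ :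
      Σ x : Γ.obj d, A.obj ⟨d, x⟩) = ⟨y, A.map (X := ⟨c, x⟩) (Y := ⟨d, y⟩) ⟨f, h⟩ a⟩ := by
  subst h
  rfl

/-- Context extension `Γ, x : A`. -/
def Ctx.ext (Γ : Ctx.{u} S) (A : Ty Γ) : Ctx.{u} S where
  obj c := Σ x : Γ.obj c, A.obj ⟨c, x⟩
  map {c d} f := ↾fun p =>
    ⟨Γ.map f p.1, A.map (X := ⟨c, p.1⟩) (Y := ⟨d, Γ.map f p.1⟩) ⟨f, rfl⟩ p.2⟩
  map_id c := by
    refine ConcreteCategory.hom_ext _ _ ?_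
    rintro ⟨x, a⟩
    refine (Ty.pair_map_eq A x x (𝟙 c) (by simp) a).trans ?_
    exact congrArg (Sigma.mk x) (ConcreteCategory.congr_hom (A.map_id ⟨c, x⟩) a)
  map_comp {c d e} f g := by
    refine ConcreteCategory.hom_ext _ _ ?_
    rintro ⟨x, a⟩
    refine (Ty.pair_map_eq A x (Γ.map g (Γ.map f x)) (f ≫ g) (by simp) a).trans ?_
    exact congrArg (Sigma.mk (Γ.map g (Γ.map f x))) (ConcreteCategory.congr_hom
      (A.map_comp (X := ⟨c, x⟩) (Y := ⟨d, Γ.map f x⟩) (Z := ⟨e, Γ.map g (Γ.map f x)⟩)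
        ⟨f, rfl⟩ ⟨g, rfl⟩) a)

/-- The weakening substitution `Γ, x : A ⟶ Γ`. -/
def Ctx.wk {Γ : Ctx.{u} S} (A : Ty Γ) : Γ.ext A ⟶ Γ where
  app _ := ↾fun p => p.1
  naturality _ _ _ := rfl

/-- The variable `x` in context `Γ, x : A`. -/
def Ctx.var {Γ : Ctx.{u} S} (A : Ty Γ) : Tm (A.subst (Ctx.wk A)) :=
  ⟨fun j => j.2.2, by
    rintro ⟨c, x⟩ ⟨d, y⟩ ⟨f, h⟩
    have key : ∀ (y : (Γ.ext A).obj d) (h : (Γ.ext A).map f x = y),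
        A.map (X := ⟨c, x.1⟩) (Y := ⟨d, y.1⟩) ⟨f, congrArg Sigma.fst h⟩ x.2 = y.2 := by
      rintro _ rfl
      rfl
    exact key y h⟩

/-- The substitution `(σ, t)` into an extended context. -/
def Ctx.pair {Γ Δ : Ctx.{u} S} {A : Ty Δ} (σ : Γ ⟶ Δ) (t : Tm (A.subst σ)) : Γ ⟶ Δ.ext A where
  app c := ↾fun x => ⟨σ.app c x, t.1 ⟨c, x⟩⟩
  naturality c d f := by
    refine ConcreteCategory.hom_ext _ _ fun x => Eq.symm ?_
    refine (Ty.pair_map_eq A (σ.app c x) (σ.app d (Γ.map f x)) f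
      (NatTrans.naturality_apply σ f x).symm _).trans ?_
    exact congrArg (Sigma.mk (σ.app d (Γ.map f x)))
      (t.2 (j := ⟨c, x⟩) (j' := ⟨d, Γ.map f x⟩) ⟨f, rfl⟩)

/-- The element `(x, a)` of an extended context. -/
abbrev Ctx.elt {Γ : Ctx.{u} S} {A : Ty Γ} (j : Γ.Elements) (a : A.obj j) : (Γ.ext A).Elements :=
  ⟨j.1, ⟨j.2, a⟩⟩

/-- The arrow from `(x, a)` to the restriction of `(x, a)` along `g`. -/
def Ctx.eltHom {Γ : Ctx.{u} S} {A : Ty Γ} {j k : Γ.Elements} (g : j ⟶ k) (a : A.obj j) :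
    Ctx.elt j a ⟶ Ctx.elt k (A.map g a) :=
  ⟨g.1, Ty.pair_map_eq A j.2 k.2 g.1 g.2 a⟩

theorem Ty.pair_eltHom_eq {Γ : Ctx.{u} S} {A : Ty Γ} (B : Ty (Γ.ext A)) {j k : Γ.Elements}
    (g : j ⟶ k) (a : A.obj j) (a' : A.obj k) (h : A.map g a = a') (b : B.obj (Ctx.elt j a)) :
    (⟨A.map g a, B.map (Ctx.eltHom g a) b⟩ : Σ a : A.obj k, B.obj (Ctx.elt k a)) =
      ⟨a', B.map (X := Ctx.elt j a) (Y := Ctx.elt k a')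
        ⟨g.1, h ▸ (Ctx.eltHom g a).2⟩ b⟩ := by
  subst h
  rfl

/-- Dependent sums `Σ (a : A). B`. -/
def Ty.sigma {Γ : Ctx.{u} S} (A : Ty Γ) (B : Ty (Γ.ext A)) : Ty Γ where
  obj j := Σ a : A.obj j, B.obj (Ctx.elt j a)
  map g := ↾fun p => ⟨A.map g p.1, B.map (Ctx.eltHom g p.1) p.2⟩
  map_id j := by
    refine ConcreteCategory.hom_ext _ _ ?_
    rintro ⟨a, b⟩
    refine (Ty.pair_eltHom_eq B (𝟙 j) a a (by simp) b).trans ?_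
    exact congrArg (Sigma.mk a) (ConcreteCategory.congr_hom (B.map_id (Ctx.elt j a)) b)
  map_comp {j k l} g g' := by
    refine ConcreteCategory.hom_ext _ _ ?_
    rintro ⟨a, b⟩
    refine (Ty.pair_eltHom_eq B (g ≫ g') a (A.map g' (A.map g a)) (by simp) b).trans ?_
    exact congrArg (Sigma.mk (A.map g' (A.map g a))) (ConcreteCategory.congr_hom
      (B.map_comp (Ctx.eltHom g a) (Ctx.eltHom g' (A.map g a))) b)

/-- Dependent products `Π (a : A). B`: compatible families indexed by the restrictions. -/
def Ty.pi {Γ : Ctx.{u} S} (A : Ty Γ) (B : Ty (Γ.ext A)) : Ty Γ where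
  obj j := { f : ∀ (k : Γ.Elements) (_ : j ⟶ k) (a : A.obj k), B.obj (Ctx.elt k a) //
    ∀ (k l : Γ.Elements) (h : j ⟶ k) (g : k ⟶ l) (a : A.obj k),
      B.map (Ctx.eltHom g a) (f k h a) = f l (h ≫ g) (A.map g a) }
  map g := ↾fun f => ⟨fun k h a => f.1 k (g ≫ h) a, fun k l h g' a => by
    rw [f.2, Category.assoc]⟩
  map_id j := by
    refine ConcreteCategory.hom_ext _ _ fun f => Subtype.ext ?_
    funext k h a
    exact congrArg (fun h => f.1 k h a) (Category.id_comp h)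
  map_comp g g' := by
    refine ConcreteCategory.hom_ext _ _ fun f => Subtype.ext ?_
    funext k h a
    exact congrArg (fun h => f.1 k h a) (Category.assoc g g' h)

theorem Ty.pi_map_apply {Γ : Ctx.{u} S} {A : Ty Γ} {B : Ty (Γ.ext A)} {j k l : Γ.Elements}
    (f : (Ty.pi A B).obj j) (h : j ⟶ k) (g : k ⟶ l) (a : A.obj k) (a' : A.obj l)
    (e : A.map g a = a') :
    B.map (X := Ctx.elt k a) (Y := Ctx.elt l a') ⟨g.1, e ▸ (Ctx.eltHom g a).2⟩ (f.1 k h a) =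
      f.1 l (h ≫ g) a' := by
  subst e
  exact f.2 k l h g a

/-- Application of a dependent function, in a context `Γ` to which the types `A` and `Π A B`
are pulled back along `σ`. -/
def Tm.app {Γ Δ : Ctx.{u} S} {A : Ty Δ} {B : Ty (Δ.ext A)} {σ : Γ ⟶ Δ}
    (f : Tm ((Ty.pi A B).subst σ)) (a : Tm (A.subst σ)) : Tm (B.subst (Ctx.pair σ a)) :=
  ⟨fun j => (f.1 j).1 ((CategoryOfElements.map σ).obj j) (𝟙 _) (a.1 j), by
    intro j k g
    refine (Ty.pi_map_apply (f.1 j) (𝟙 _) ((CategoryOfElements.map σ).map g) (a.1 j) (a.1 k)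
      (a.2 g)).trans ?_
    refine Eq.trans ?_ (congrArg (fun q : (Ty.pi A B).obj ((CategoryOfElements.map σ).obj k) =>
      q.1 ((CategoryOfElements.map σ).obj k) (𝟙 _) (a.1 k)) (f.2 g))
    exact congrArg (fun h => (f.1 j).1 ((CategoryOfElements.map σ).obj k) h (a.1 k))
      ((Category.id_comp _).trans (Category.comp_id _).symm)⟩

/-- Non-dependent function types. -/
def Ty.arrow {Γ : Ctx.{u} S} (A B : Ty Γ) : Ty Γ := Ty.pi A (B.subst (Ctx.wk A))

/-- Extensional identity types. -/
def Ty.id {Γ : Ctx.{u} S} {A : Ty Γ} (t s : Tm A) : Ty Γ where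
  obj j := ULift (PLift (t.1 j = s.1 j))
  map g := ↾fun p => ⟨⟨by rw [← t.2 g, ← s.2 g, p.down.down]⟩⟩

/-- The empty context: the terminal presheaf. -/
def Ctx.empty : Ctx.{u} S := (Functor.const _).obj PUnit

/-- A presheaf `X`, seen as a closed type and weakened to the context `Γ`. -/
abbrev Ctx.asTy (X Γ : Ctx.{u} S) : Ty Γ := CategoryOfElements.π Γ ⋙ X

/-- A term of the closed type `X` in context `Γ`, as a morphism of presheaves. -/
def Tm.toHom {X Γ : Ctx.{u} S} (t : Tm (X.asTy Γ)) : Γ ⟶ X where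
  app c := ↾fun x => t.1 ⟨c, x⟩
  naturality c d f := by
    refine ConcreteCategory.hom_ext _ _ fun x => Eq.symm ?_
    exact t.2 (j := ⟨c, x⟩) (j' := ⟨d, Γ.map f x⟩) ⟨f, rfl⟩

/-- The object of truth values: the presheaf of sieves. -/
def Omega : Ctx.{u} S := Functor.sieves S ⋙ uliftFunctor.{u}

end CwF

/-! ### The interval, faces and compositions -/

/-- The interval of cubical sets, `I ↦ dM(I)`. -/
def cubeInterval : Cubeᵒᵖ ⥤ Type 0 where
  obj I := FreeDM I.unop.names
  map f := ↾fun r => FreeDM.lift f.unop r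
  map_id I := by
    refine ConcreteCategory.hom_ext _ _ fun r => ?_
    exact FreeDM.lift_of_self r
  map_comp f g := by
    refine ConcreteCategory.hom_ext _ _ fun r => ?_
    exact (FreeDM.lift_lift g.unop f.unop r).symm

/-- The interval `𝕀` in presheaves on `𝒞 × ω`: precomposition of the interval of cubical
sets with the projection to `𝒞`. -/
def Itv : Ctx.{u} CubeOmega := (CategoryTheory.Prod.fst Cube ℕ).op ⋙ cubeInterval ⋙ uliftFunctor.{u}

/-- The endpoint `0` of the interval. -/
def Itv.zero (Γ : Ctx.{u} CubeOmega) : Tm (Itv.asTy Γ) :=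
  ⟨fun j => ULift.up (⊥ : FreeDM j.1.unop.1.names), fun _ => rfl⟩

/-- The endpoint `1` of the interval. -/
def Itv.one (Γ : Ctx.{u} CubeOmega) : Tm (Itv.asTy Γ) :=
  ⟨fun j => ULift.up (⊤ : FreeDM j.1.unop.1.names), fun _ => rfl⟩

/-- The truth value `r = 1` at stage `c`. -/
def Itv.eqOneSieve {c : CubeOmegaᵒᵖ} (r : Itv.{u}.obj c) : Sieve c.unop where
  arrows d f := Itv.map f.op r = ULift.up (⊤ : FreeDM d.1.names)
  downward_closed := by
    intro d e f h g
    rw [op_comp, Functor.map_comp_apply, h]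
    rfl

/-- The map `(· = 1) : 𝕀 ⟶ Ω`. -/
def Itv.eqOne : Itv.{u} ⟶ Omega.{u} where
  app c := ↾fun r => ULift.up (Itv.eqOneSieve r)
  naturality c d f := by
    refine ConcreteCategory.hom_ext _ _ fun r => ?_
    refine congrArg ULift.up (Sieve.ext fun e g => ?_)
    change Itv.map g.op (Itv.map f r) = _ ↔ Itv.map (g ≫ f.unop).op r = _
    rw [op_comp, Functor.map_comp_apply]
    rfl

theorem Itv.eqOne_top (c : CubeOmegaᵒᵖ) :
    Itv.eqOne.{u}.app c (ULift.up (⊤ : FreeDM c.unop.1.names)) =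
      ULift.up (⊤ : Sieve c.unop) := by
  refine congrArg ULift.up (Sieve.ext fun e g => ?_)
  exact ⟨fun _ => trivial, fun _ => rfl⟩

/-- The type `𝔽` of faces: the image of `(· = 1) : 𝕀 ⟶ Ω`. -/
def Face : Ctx.{u} CubeOmega := (Subfunctor.range Itv.eqOne.{u}).toFunctor

/-- The face `⊤`. -/
def Face.top (Γ : Ctx.{u} CubeOmega) : Tm (Face.asTy Γ) :=
  ⟨fun j => Subtype.mk (ULift.up (⊤ : Sieve j.1.unop) : Omega.{u}.obj j.1)
      ⟨ULift.up (⊤ : FreeDM j.1.unop.1.names), Itv.eqOne_top j.1⟩,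
    fun f => Subtype.ext (congrArg ULift.up (Sieve.pullback_top (f := f.1.unop)))⟩

section Comp

variable {Γ : Ctx.{u} CubeOmega}

/-- The type `[φ]`. -/
def Face.ty (φ : Tm (Face.asTy Γ)) : Ty Γ := Ty.id φ (Face.top Γ)

/-- The type `A[φ ↦ u] = Σ (a : A). Π (p : [φ]). Id a u`, for `u : A` in context `Γ, [φ]`. -/
def Ty.extent (A : Ty Γ) (φ : Tm (Face.asTy Γ)) (v : Tm (A.subst (Ctx.wk (Face.ty φ)))) : Ty Γ :=
  Ty.sigma A (Ty.pi ((Face.ty φ).subst (Ctx.wk A))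
    (Ty.id (A := (A.subst (Ctx.wk A)).subst (Ctx.wk _))
      ((Ctx.var A).subst (Ctx.wk ((Face.ty φ).subst (Ctx.wk A))))
      (v.subst (Ctx.pair (A := Face.ty φ) (Ctx.wk ((Face.ty φ).subst (Ctx.wk A)) ≫ Ctx.wk A) (Ctx.var ((Face.ty φ).subst (Ctx.wk A)))))))

variable (Γ) in
/-- The closed type `𝕀 → Γ`. -/
def pathTy : Ty (Ctx.empty.{u} (S := CubeOmega)) := Ty.arrow (Itv.asTy _) (Γ.asTy _)

variable (Γ) in
/-- The context `γ : 𝕀 → Γ`. -/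
abbrev pathCtx : Ctx.{u} CubeOmega := Ctx.empty.ext (pathTy Γ)

/-- The substitution `γ(i)` into `Γ`, for `γ` provided by `σ` and a term `i : 𝕀`. -/
def pathAt {X : Ctx.{u} CubeOmega} (σ : X ⟶ pathCtx Γ) (i : Tm (Itv.asTy X)) : X ⟶ Γ :=
  Tm.toHom (Tm.app (A := Itv.asTy Ctx.empty) (σ := σ ≫ Ctx.wk _)
    ((Ctx.var (pathTy Γ)).subst σ) i)

variable (Γ) in
/-- The context `γ : 𝕀 → Γ, φ : 𝔽`. -/
abbrev faceCtx : Ctx.{u} CubeOmega := (pathCtx Γ).ext (Face.asTy _)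

variable (Γ) in
/-- The variable `φ` in context `γ : 𝕀 → Γ, φ : 𝔽`. -/
def faceVar : Tm (Face.asTy (faceCtx Γ)) := Ctx.var (Face.asTy (pathCtx Γ))

variable (Γ) in
/-- The context `γ : 𝕀 → Γ, φ : 𝔽, i : 𝕀`. -/
abbrev itvCtx : Ctx.{u} CubeOmega := (faceCtx Γ).ext (Itv.asTy _)

variable (Γ) in
/-- The type `[φ]` in context `γ : 𝕀 → Γ, φ : 𝔽, i : 𝕀`. -/
abbrev itvFace : Ty (itvCtx Γ) := (Face.ty (faceVar Γ)).subst (Ctx.wk _)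

/-- The type `A(γ(i))` in context `γ : 𝕀 → Γ, φ : 𝔽, i : 𝕀, p : [φ]`. -/
def sysFibre (A : Ty Γ) : Ty ((itvCtx Γ).ext (itvFace Γ)) :=
  A.subst (pathAt (Ctx.wk (itvFace Γ) ≫ Ctx.wk (Itv.asTy (faceCtx Γ)) ≫ Ctx.wk _)
    ((Ctx.var (Itv.asTy (faceCtx Γ))).subst (Ctx.wk (itvFace Γ))))

/-- The type `Π (i : 𝕀). Π (p : [φ]). A(γ(i))` in context `γ : 𝕀 → Γ, φ : 𝔽`. -/
def sysTy (A : Ty Γ) : Ty (faceCtx Γ) :=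
  Ty.pi (Itv.asTy _) (Ty.pi (itvFace Γ) (sysFibre A))

/-- The context `γ : 𝕀 → Γ, φ : 𝔽, u : Π (i : 𝕀). Π (p : [φ]). A(γ(i))`. -/
abbrev sysCtx (A : Ty Γ) : Ctx.{u} CubeOmega := (faceCtx Γ).ext (sysTy A)

/-- The variable `φ` in context `γ, φ, u`. -/
def sysFace (A : Ty Γ) : Tm (Face.asTy (sysCtx A)) := (faceVar Γ).subst (Ctx.wk (sysTy A))

/-- The type `A(γ(i))` in context `γ, φ, u`, for a term `i : 𝕀`. -/
def fibreAt (A : Ty Γ) (i : Tm (Itv.asTy (sysCtx A))) : Ty (sysCtx A) :=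
  A.subst (pathAt (Ctx.wk (sysTy A) ≫ Ctx.wk _) i)

/-- The term `u(i) : A(γ(i))` in context `γ, φ, u, p : [φ]`, for a term `i : 𝕀`. -/
def sysAt (A : Ty Γ) (i : Tm (Itv.asTy (sysCtx A))) :
    Tm ((fibreAt A i).subst (Ctx.wk (Face.ty (sysFace A)))) :=
  let p := Ctx.wk (Face.ty (sysFace A))
  let ui := Tm.app (A := Itv.asTy (faceCtx Γ)) (B := Ty.pi (itvFace Γ) (sysFibre A))
    (σ := p ≫ Ctx.wk (sysTy A)) ((Ctx.var (sysTy A)).subst p) (i.subst p)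
  Tm.app (A := itvFace Γ) (B := sysFibre A) ui (Ctx.var (Face.ty (sysFace A)))

/-- The closed type of compositions
`Π (γ : 𝕀 → Γ) (φ : 𝔽) (u : Π (i : 𝕀). Π (p : [φ]). A(γ(i))).
  A(γ(0))[φ ↦ u(0)] → A(γ(1))[φ ↦ u(1)]`. -/
def CompTy (A : Ty Γ) : Ty (Ctx.empty.{u} (S := CubeOmega)) :=
  Ty.pi (pathTy Γ) (Ty.pi (Face.asTy (pathCtx Γ)) (Ty.pi (sysTy A)
    (Ty.arrow
      ((fibreAt A (Itv.zero _)).extent (sysFace A) (sysAt A (Itv.zero _)))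
      ((fibreAt A (Itv.one _)).extent (sysFace A) (sysAt A (Itv.one _))))))

end Comp

/-! ### Later types and delayed substitutions -/

section Later

/-- `(▷ X)(I, 0) = {⋆}` and `(▷ X)(I, n + 1) = X(I, n)`. -/
def laterObj (X : Ctx.{u} CubeOmega) (I : Cube) : ℕ → Type u
  | 0 => PUnit
  | n + 1 => X.obj (Opposite.op (I, n))

/-- The restriction maps of `▷ X`. -/
def laterMap (X : Ctx.{u} CubeOmega) {I J : Cube} (f : J ⟶ I) :
    {n m : ℕ} → m ≤ n → laterObj X I n → laterObj X J m
  | _, 0, _, _ => PUnit.unit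
  | 0, _ + 1, h, _ => absurd h (Nat.not_succ_le_zero _)
  | n + 1, m + 1, h, x => X.map (X := Opposite.op (I, n)) (Y := Opposite.op (J, m))
      (Quiver.Hom.op (Prod.mkHom f (homOfLE (Nat.le_of_succ_le_succ h)))) x

/-- The presheaf `▷ X`. -/
def Ctx.later (X : Ctx.{u} CubeOmega) : Ctx.{u} CubeOmega where
  obj c := laterObj X c.unop.1 c.unop.2
  map f := ↾(laterMap X f.unop.1 (leOfHom f.unop.2))
  map_id c := by
    obtain ⟨⟨I, n⟩⟩ := c
    refine ConcreteCategory.hom_ext _ _ fun x => ?_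
    cases n with
    | zero => rfl
    | succ n => exact ConcreteCategory.congr_hom (X.map_id (Opposite.op (I, n))) x
  map_comp {c d e} f g := by
    obtain ⟨⟨I, n⟩⟩ := c
    obtain ⟨⟨J, m⟩⟩ := d
    obtain ⟨⟨K, l⟩⟩ := e
    have h1 : m ≤ n := leOfHom f.unop.2
    have h2 : l ≤ m := leOfHom g.unop.2
    refine ConcreteCategory.hom_ext _ _ fun x => ?_
    cases l with
    | zero => rfl
    | succ l =>
      cases m with
      | zero => omega
      | succ m =>
        cases n with
        | zero => omega
        | succ n =>
          exact ConcreteCategory.congr_hom (X.map_comp (X := Opposite.op (I, n))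
            (Y := Opposite.op (J, m)) (Z := Opposite.op (K, l))
            (Quiver.Hom.op (Prod.mkHom f.unop.1 (homOfLE (Nat.le_of_succ_le_succ h1))))
            (Quiver.Hom.op (Prod.mkHom g.unop.1 (homOfLE (Nat.le_of_succ_le_succ h2))))) x

/-- The canonical map `next : X ⟶ ▷ X`. -/
def Ctx.next (X : Ctx.{u} CubeOmega) : X ⟶ X.later where
  app c := ↾(match c with
    | ⟨(_, 0)⟩ => fun _ => PUnit.unit
    | ⟨(I, n + 1)⟩ => fun x => X.map (X := Opposite.op (I, n + 1)) (Y := Opposite.op (I, n))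
      (Quiver.Hom.op (Prod.mkHom (𝟙 I) (homOfLE n.le_succ))) x)
  naturality c d f := by
    obtain ⟨⟨I, n⟩⟩ := c
    obtain ⟨⟨J, m⟩⟩ := d
    have h1 : m ≤ n := leOfHom f.unop.2
    refine ConcreteCategory.hom_ext _ _ fun x => ?_
    cases m with
    | zero => rfl
    | succ m =>
      cases n with
      | zero => omega
      | succ n =>
        let p : Opposite.op (I, n + 1) ⟶ Opposite.op (I, n) :=
          Quiver.Hom.op (Prod.mkHom (𝟙 I) (homOfLE n.le_succ))
        let q : Opposite.op (J, m + 1) ⟶ Opposite.op (J, m) :=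
          Quiver.Hom.op (Prod.mkHom (𝟙 J) (homOfLE m.le_succ))
        let g : Opposite.op (I, n) ⟶ Opposite.op (J, m) :=
          Quiver.Hom.op (Prod.mkHom f.unop.1 (homOfLE (Nat.le_of_succ_le_succ h1)))
        have e : f ≫ q = p ≫ g := by
          apply Quiver.Hom.unop_inj
          refine Prod.ext ?_ (Subsingleton.elim _ _)
          exact (Category.id_comp f.unop.1).trans (Category.comp_id f.unop.1).symm
        refine (X.map_comp_apply f q x).symm.trans (Eq.trans ?_ (X.map_comp_apply p g x))
        exact congrArg (fun r => X.map r x) e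

variable {Γ Δ : Ctx.{u} CubeOmega}

/-- Fibres of the type over `▷ Δ` obtained by applying `▷` to a type over `Δ`. -/
def laterTyObj (A : Ty Δ) (I : Cube) : (n : ℕ) → laterObj Δ I n → Type u
  | 0, _ => PUnit
  | n + 1, x => A.obj ⟨Opposite.op (I, n), x⟩

/-- Restriction maps of the type over `▷ Δ` obtained by applying `▷` to a type over `Δ`. -/
def laterTyMap (A : Ty Δ) {I J : Cube} (f : J ⟶ I) :
    {n m : ℕ} → (h : m ≤ n) → (x : laterObj Δ I n) → (y : laterObj Δ J m) →
      laterMap Δ f h x = y → laterTyObj A I n x → laterTyObj A J m y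
  | _, 0, _, _, _, _, _ => PUnit.unit
  | 0, _ + 1, h, _, _, _, _ => absurd h (Nat.not_succ_le_zero _)
  | n + 1, m + 1, h, x, y, e, a =>
    A.map (X := ⟨Opposite.op (I, n), x⟩) (Y := ⟨Opposite.op (J, m), y⟩)
      ⟨Quiver.Hom.op (Prod.mkHom f (homOfLE (Nat.le_of_succ_le_succ h))), e⟩ a

/-- The action of `▷` on types: for `A` over `Δ` a type over `▷ Δ`, with fibre `{⋆}` over
elements at `(I, 0)` and fibre `A(I, n)(x)` over `x ∈ (▷ Δ)(I, n + 1) = Δ(I, n)`. -/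
def Ty.later (A : Ty Δ) : Ty Δ.later where
  obj j := laterTyObj A j.1.unop.1 j.1.unop.2 j.2
  map {j k} g := ↾(laterTyMap A g.1.unop.1 (leOfHom g.1.unop.2) j.2 k.2 g.2)
  map_id j := by
    obtain ⟨⟨⟨I, n⟩⟩, x⟩ := j
    refine ConcreteCategory.hom_ext _ _ fun a => ?_
    cases n with
    | zero => rfl
    | succ n => exact ConcreteCategory.congr_hom (A.map_id ⟨Opposite.op (I, n), x⟩) a
  map_comp {j k l} f g := by
    obtain ⟨⟨⟨I, n⟩⟩, x⟩ := j
    obtain ⟨⟨⟨J, m⟩⟩, y⟩ := k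
    obtain ⟨⟨⟨K, l⟩⟩, z⟩ := l
    have h1 : m ≤ n := leOfHom f.1.unop.2
    have h2 : l ≤ m := leOfHom g.1.unop.2
    refine ConcreteCategory.hom_ext _ _ fun a => ?_
    cases l with
    | zero => rfl
    | succ l =>
      cases m with
      | zero => omega
      | succ m =>
        cases n with
        | zero => omega
        | succ n =>
          exact ConcreteCategory.congr_hom (A.map_comp (X := ⟨Opposite.op (I, n), x⟩)
            (Y := ⟨Opposite.op (J, m), y⟩) (Z := ⟨Opposite.op (K, l), z⟩)
            ⟨Quiver.Hom.op (Prod.mkHom f.1.unop.1 (homOfLE (Nat.le_of_succ_le_succ h1))), f.2⟩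
            ⟨Quiver.Hom.op (Prod.mkHom g.1.unop.1 (homOfLE (Nat.le_of_succ_le_succ h2))), g.2⟩) a

/-- The substitution `(σ, t) : Γ ⟶ ▷ (Δ, x : A)` given by `σ : Γ ⟶ ▷ Δ` and a term `t` of the
type `▷ A` over `▷ Δ` pulled back along `σ`. -/
def Ctx.laterPair {A : Ty Δ} (σ : Γ ⟶ Δ.later) (t : Tm (A.later.subst σ)) :
    Γ ⟶ (Δ.ext A).later where
  app c := ↾(match c with
    | ⟨(_, 0)⟩ => fun _ => PUnit.unit
    | ⟨(I, n + 1)⟩ => fun x =>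
      ⟨σ.app (Opposite.op (I, n + 1)) x, t.1 ⟨Opposite.op (I, n + 1), x⟩⟩)
  naturality c d f := by
    obtain ⟨⟨I, n⟩⟩ := c
    obtain ⟨⟨J, m⟩⟩ := d
    have h1 : m ≤ n := leOfHom f.unop.2
    refine ConcreteCategory.hom_ext _ _ fun x => ?_
    cases m with
    | zero => rfl
    | succ m =>
      cases n with
      | zero => omega
      | succ n =>
        refine Eq.symm ?_
        refine (Ty.pair_map_eq A (c := Opposite.op (I, n)) (d := Opposite.op (J, m))
          (σ.app (Opposite.op (I, n + 1)) x) (σ.app (Opposite.op (J, m + 1)) (Γ.map f x))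
          (Quiver.Hom.op (Prod.mkHom f.unop.1 (homOfLE (Nat.le_of_succ_le_succ h1))))
          (NatTrans.naturality_apply σ f x).symm _).trans ?_
        exact congrArg (Sigma.mk (σ.app (Opposite.op (J, m + 1)) (Γ.map f x)))
          (t.2 (j := ⟨Opposite.op (I, n + 1), x⟩) (j' := ⟨Opposite.op (J, m + 1), Γ.map f x⟩)
            ⟨f, rfl⟩)

/-- Delayed substitutions `ξ : Γ ⇾ Γ'`. The index `Δ` is the context `Γ, Γ'`, and the index
`σ : Γ ⟶ ▷ (Γ, Γ')` is the interpretation of `ξ`. The empty delayed substitution is interpreted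
by `next`, and if `t` is a term of `▷ξ A`, where `A` is a type in context `Γ, Γ'`, then `ξ[x ← t]`
is a delayed substitution from `Γ` to `Γ', x : A`. Here `▷ξ A` is the type `▷ A` over `▷ (Γ, Γ')`
pulled back along `σ`. -/
inductive DelayedSubst (Γ : Ctx.{u} CubeOmega) :
    (Δ : Ctx.{u} CubeOmega) → (Γ ⟶ Δ.later) → Type (u + 1)
  | nil : DelayedSubst Γ Γ Γ.next
  | snoc {Δ : Ctx.{u} CubeOmega} {σ : Γ ⟶ Δ.later} (ξ : DelayedSubst Γ Δ σ) (A : Ty Δ)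
      (t : Tm (A.later.subst σ)) : DelayedSubst Γ (Δ.ext A) (Ctx.laterPair σ t)

/-- The type `▷ξ A` in context `Γ`, for a type `A` in context `Γ, Γ'`. -/
def DelayedSubst.later {σ : Γ ⟶ Δ.later} (_ξ : DelayedSubst Γ Δ σ) (A : Ty Δ) : Ty Γ :=
  A.later.subst σ

end Later

end GCTT

open GCTT

/-! The functor `▷` has a left adjoint, `Ctx.earlier`, with value `X(I, n + 1)` at `(I, n)`. A
substitution `σ : Γ ⟶ ▷Δ` transposes to `earlier Γ ⟶ Δ`, and a term of `▷A` over a context `Y`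
amounts to a term of `A` over `earlier Y`, because the fibre of `▷A` at stage `n + 1` is that of `A`
at stage `n` and its fibre at stage `0` is a point. A composition structure is the same as a term of
`A(γ(1))[φ ↦ u(1)]` in context `γ, φ, u, a`. It therefore suffices to turn a composition problem for
`▷A` at stage `n + 1` into one for `A` at stage `n`, apply the given structure, and transpose the
answer back.

The problem can be moved because neither the interval nor the truth of `r = 1` depends on `n`. Paths
transpose pointwise (`pathMap`). A face at stage `n + 1` is `⊤` exactly when its restriction to
stage `n` is (`Face.eq_top_of_earlierTo`, `faceMap_eq_top`), so `u` transposes to a system on the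
restricted face (`sysTm`), and `a` to a base for it (`baseTm`). The boundary conditions then follow
from the compatibility of `u` with transposition (`sysAt_sysMap_zero`, `sysAt_sysMap_one`). -/

namespace GCTT

/-! ### Dependent products pulled back along a substitution -/

section CwF

variable {S : Type} [SmallCategory S]

/-- Abstraction of a term over the last variable. -/
def Tm.lam {Γ : Ctx.{u} S} {A : Ty Γ} {B : Ty (Γ.ext A)} (b : Tm B) : Tm (Ty.pi A B) :=
  ⟨fun _ => ⟨fun k _ a => b.1 (Ctx.elt k a), fun _ _ _ g a => b.2 (Ctx.eltHom g a)⟩,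
    fun _ => rfl⟩

/-- Application of a term of a dependent product to a fresh variable. -/
def Tm.unlam {Γ : Ctx.{u} S} {A : Ty Γ} {B : Ty (Γ.ext A)} (t : Tm (Ty.pi A B)) : Tm B :=
  ⟨fun j => (t.1 ⟨j.1, j.2.1⟩).1 ⟨j.1, j.2.1⟩ (𝟙 _) j.2.2, by
    intro j k g
    exact (Tm.app (A := A) (B := B) (σ := Ctx.wk A) (t.subst (Ctx.wk A)) (Ctx.var A)).2 g⟩

/-- The substitution `(σ, x)` from `Γ, x : A[σ]` to `Δ, x : A`. -/
abbrev Ctx.under {Γ Δ : Ctx.{u} S} (σ : Γ ⟶ Δ) (A : Ty Δ) : Γ.ext (A.subst σ) ⟶ Δ.ext A :=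
  Ctx.pair (Ctx.wk (A.subst σ) ≫ σ) (Ctx.var (A.subst σ))

/-- The value at `(y, a)` of a family given over the elements of `Δ, x : A` which lie over `Γ`. -/
def Tm.transportAlong {Γ Δ : Ctx.{u} S} {A : Ty Δ} {B : Ty (Δ.ext A)} {σ : Γ ⟶ Δ}
    (b : Tm (B.subst (Ctx.under σ A))) {d : Sᵒᵖ} (x : Γ.obj d) (y : Δ.obj d)
    (e : σ.app d x = y) (a : A.obj ⟨d, y⟩) : B.obj ⟨d, ⟨y, a⟩⟩ := by
  subst e
  exact b.1 ⟨d, ⟨x, a⟩⟩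

/-- Once the equations are substituted away, this is the naturality of `b`. -/
theorem Tm.map_transportAlong {Γ Δ : Ctx.{u} S} {A : Ty Δ} {B : Ty (Δ.ext A)} {σ : Γ ⟶ Δ}
    (b : Tm (B.subst (Ctx.under σ A))) {c d : Sᵒᵖ} {y : Δ.obj c} {z : Δ.obj d} (g : c ⟶ d)
    (hg : Δ.map g y = z) (x : Γ.obj c) (x' : Γ.obj d) (hx : Γ.map g x = x')
    (e : σ.app c x = y) (e' : σ.app d x' = z) (a : A.obj ⟨c, y⟩) :
    B.map (Ctx.eltHom (j := ⟨c, y⟩) (k := ⟨d, z⟩) ⟨g, hg⟩ a) (Tm.transportAlong b x y e a) =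
      Tm.transportAlong b x' z e' (A.map (X := ⟨c, y⟩) (Y := ⟨d, z⟩) ⟨g, hg⟩ a) := by
  subst e hx e'
  exact b.2 (Ctx.eltHom (A := A.subst σ) (j := ⟨c, x⟩) (k := ⟨d, Γ.map g x⟩) ⟨g, rfl⟩ a)

theorem Tm.transportAlong_self {Γ Δ : Ctx.{u} S} {A : Ty Δ} {B : Ty (Δ.ext A)} {σ : Γ ⟶ Δ}
    (b : Tm (B.subst (Ctx.under σ A))) {d : Sᵒᵖ} (x x' : Γ.obj d) (h : x' = x)
    (e : σ.app d x' = σ.app d x) (a : A.obj ⟨d, σ.app d x⟩) :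
    Tm.transportAlong b x' (σ.app d x) e a = b.1 ⟨d, ⟨x, a⟩⟩ := by
  subst h
  rfl

/-- Abstraction for dependent products which are pulled back along a substitution. -/
def Tm.lamAlong {Γ Δ : Ctx.{u} S} {A : Ty Δ} {B : Ty (Δ.ext A)} {σ : Γ ⟶ Δ}
    (b : Tm (B.subst (Ctx.under σ A))) : Tm ((Ty.pi A B).subst σ) :=
  -- An arrow `h` out of the image of `j` ends at the image of the restriction of `j` along `h`. So
  -- `k.2` comes from `Γ`, but only up to a propositional equality, along which `b` is transported.
  ⟨fun j => ⟨fun k h a => Tm.transportAlong b (Γ.map h.1 j.2) k.2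
      ((NatTrans.naturality_apply σ h.1 j.2).trans h.2) a, fun k l h g a =>
      Tm.map_transportAlong b g.1 g.2 (Γ.map h.1 j.2) (Γ.map (h.1 ≫ g.1) j.2)
        (Γ.map_comp_apply h.1 g.1 j.2).symm
        ((NatTrans.naturality_apply σ h.1 j.2).trans h.2) _ a⟩, by
    rintro ⟨c, x⟩ ⟨d, y⟩ ⟨f, hf⟩
    refine Subtype.ext ?_
    funext k h a
    have key : ∀ x₁ x₂ : Γ.obj k.1, x₁ = x₂ → ∀ (e₁ : σ.app k.1 x₁ = k.2)
        (e₂ : σ.app k.1 x₂ = k.2),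
        Tm.transportAlong b x₁ k.2 e₁ a = Tm.transportAlong b x₂ k.2 e₂ a := by
      rintro x _ rfl _ _
      rfl
    refine key _ _ ?_ _ _
    exact (Γ.map_comp_apply f h.1 x).trans (congrArg (Γ.map h.1) hf)⟩

/-- The β-rule. It is not definitional, since the abstraction is evaluated at the restriction of
`j.2` along the identity. -/
theorem Tm.lamAlong_app {Γ Δ : Ctx.{u} S} {A : Ty Δ} {B : Ty (Δ.ext A)} {σ : Γ ⟶ Δ}
    (b : Tm (B.subst (Ctx.under σ A))) (j : Γ.Elements) (a : (A.subst σ).obj j) :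
    ((Tm.lamAlong b).1 j).1 ((CategoryOfElements.map σ).obj j) (𝟙 _) a =
      b.1 (Ctx.elt (A := A.subst σ) j a) :=
  Tm.transportAlong_self b j.2 _ (Γ.map_id_apply j.1 j.2) _ a

end CwF

theorem Ty.id_ext {S : Type} [SmallCategory S] {Γ : Ctx.{u} S} {A : Ty Γ} {t s : Tm A}
    {j : Γ.Elements} (p q : (Ty.id t s).obj j) : p = q := by
  obtain ⟨⟨_⟩⟩ := p
  obtain ⟨⟨_⟩⟩ := q
  rfl

/-! ### Terms of `A[φ ↦ v]` as terms of `A` with a boundary condition -/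

section Extent

variable {Γ Y : Ctx.{u} CubeOmega} {A : Ty Γ} {φ : Tm (Face.asTy Γ)}
  {v : Tm (A.subst (Ctx.wk (Face.ty φ)))} {τ : Y ⟶ Γ}

/-- The underlying term of `A` of a term of `A[φ ↦ v]`. -/
def Tm.extentFst (t : Tm ((A.extent φ v).subst τ)) : Tm (A.subst τ) :=
  ⟨fun j => (t.1 j).1, fun g => congrArg Sigma.fst (t.2 g)⟩

theorem Tm.extentFst_eq (t : Tm ((A.extent φ v).subst τ)) (j : Y.Elements)
    (p : ((Face.ty φ).subst τ).obj j) :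
    (Tm.extentFst t).1 j = v.1 (Ctx.elt (A := Face.ty φ) ((CategoryOfElements.map τ).obj j) p) :=
  ((t.1 j).2.1 _ (𝟙 _) p).down.down

/-- The second component is a family of identity proofs, which carries no data. -/
theorem Ty.extent_ext {j : Γ.Elements} {a b : (A.extent φ v).obj j} (h : a.1 = b.1) : a = b := by
  obtain ⟨a, α⟩ := a
  obtain ⟨b, β⟩ := b
  dsimp only at h
  subst h
  exact congrArg (Sigma.mk a)
    (Subtype.ext (funext fun _ => funext fun _ => funext fun _ => Ty.id_ext _ _))

/-- The boundary component of `A[φ ↦ v]` quantifies over all later restrictions. Any `(y, a')`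
reached from the value of `a` at `j` is the value of `a` at a restriction of `j`, so agreement over
the elements of `Y` is enough. -/
theorem Tm.eq_of_extent_arrow (a : Tm (A.subst τ))
    (h : ∀ (j : Y.Elements) (p : ((Face.ty φ).subst τ).obj j),
      a.1 j = v.1 (Ctx.elt (A := Face.ty φ) ((CategoryOfElements.map τ).obj j) p))
    (j : Y.Elements) {d : CubeOmegaᵒᵖ} (y : Γ.obj d) (a' : A.obj ⟨d, y⟩) (g : j.1 ⟶ d)
    (hg : (Γ.ext A).map g ⟨τ.app j.1 j.2, a.1 j⟩ = ⟨y, a'⟩) (p : (Face.ty φ).obj ⟨d, y⟩) :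
    a' = v.1 (Ctx.elt (A := Face.ty φ) ⟨d, y⟩ p) := by
  have e := (Ty.pair_map_eq A (c := j.1) (d := d) (τ.app j.1 j.2) (τ.app d (Y.map g j.2)) g
    (NatTrans.naturality_apply τ g j.2).symm (a.1 j)).symm.trans hg
  have e' := congrArg (Sigma.mk (β := fun x => A.obj ⟨d, x⟩) (τ.app d (Y.map g j.2)))
    (a.2 (j := j) (j' := ⟨d, Y.map g j.2⟩) ⟨g, rfl⟩)
  cases e'.symm.trans e
  exact h ⟨d, Y.map g j.2⟩ p

/-- A term of `A` which agrees with `v` on `φ` is a term of `A[φ ↦ v]`. -/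
def Tm.extentMk (a : Tm (A.subst τ))
    (h : ∀ (j : Y.Elements) (p : ((Face.ty φ).subst τ).obj j),
      a.1 j = v.1 (Ctx.elt (A := Face.ty φ) ((CategoryOfElements.map τ).obj j) p)) :
    Tm ((A.extent φ v).subst τ) :=
  ⟨fun j => ⟨a.1 j, ⟨fun k g p => ⟨⟨
      Tm.eq_of_extent_arrow a h j (d := k.1) k.2.1 k.2.2 g.1 g.2 p⟩⟩,
    fun _ _ _ _ _ => Ty.id_ext _ _⟩⟩, fun g => Ty.extent_ext (a.2 g)⟩

end Extent

/-! ### The left adjoint of `▷`, and its effect on faces -/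

/-- The functor `(I, n) ↦ (I, n + 1)`. -/
def nextStage : CubeOmega ⥤ CubeOmega where
  obj c := (c.1, c.2 + 1)
  map f := Prod.mkHom f.1 (homOfLE (Nat.succ_le_succ (leOfHom f.2)))

/-- The restriction of a presheaf along `(I, n) ↦ (I, n + 1)`, which is left adjoint to `▷`. -/
abbrev Ctx.earlier (X : Ctx.{u} CubeOmega) : Ctx.{u} CubeOmega := nextStage.op ⋙ X

/-- The action of `Ctx.earlier` on substitutions. -/
abbrev Ctx.earlierMap {X Y : Ctx.{u} CubeOmega} (τ : X ⟶ Y) : X.earlier ⟶ Y.earlier :=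
  Functor.whiskerLeft nextStage.op τ

/-- The arrow from `(I, n)` to `(I, n + 1)`. -/
def nextStageHom (c : CubeOmega) : c ⟶ nextStage.obj c :=
  Prod.mkHom (𝟙 c.1) (homOfLE c.2.le_succ)

theorem nextStageHom_naturality {c d : CubeOmega} (f : c ⟶ d) :
    f ≫ nextStageHom d = nextStageHom c ≫ nextStage.map f :=
  Prod.ext ((Category.comp_id f.1).trans (Category.id_comp f.1).symm) (Subsingleton.elim _ _)

/-- An element of the restriction of `X` at `(I, n)`, as an element of `X` at `(I, n + 1)`. -/
abbrev Ctx.nextElt {X : Ctx.{u} CubeOmega} (j : X.earlier.Elements) : X.Elements :=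
  ⟨nextStage.op.obj j.1, j.2⟩

/-- The action of `Ctx.nextElt` on arrows. -/
abbrev Ctx.nextEltHom {X : Ctx.{u} CubeOmega} {j k : X.earlier.Elements} (g : j ⟶ k) :
    Ctx.nextElt j ⟶ Ctx.nextElt k := ⟨nextStage.op.map g.1, g.2⟩

section

variable {Γ Δ Y : Ctx.{u} CubeOmega}

/-- The transpose of a substitution `Y ⟶ ▷ Δ`. -/
def Ctx.transpose (τ : Y ⟶ Δ.later) : Y.earlier ⟶ Δ where
  app c := ↾fun y => τ.app (nextStage.op.obj c) y
  naturality _ _ f := ConcreteCategory.hom_ext _ _ fun y =>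
    NatTrans.naturality_apply τ (nextStage.op.map f) y

/-- Restriction from stage `(I, n + 1)` to `(I, n)`. -/
def Ctx.earlierTo (X : Ctx.{u} CubeOmega) : X.earlier ⟶ X where
  app c := X.map (nextStageHom c.unop).op
  naturality c d f := by
    refine (X.map_comp _ _).symm.trans (Eq.trans ?_ (X.map_comp _ _))
    exact congrArg X.map (Quiver.Hom.unop_inj (nextStageHom_naturality f.unop)).symm

/-- A face is `r = 1` for some `r ∈ dM(I)`, and restriction from `(I, n + 1)` to `(I, n)` is the
identity on `dM(I)`. Testing the restricted sieve on the identity arrow gives `r = 1`. For a general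
truth value this would fail. -/
theorem Face.eq_top_of_earlierTo {c : CubeOmegaᵒᵖ} (φ : Face.{u}.earlier.obj c)
    (h : Face.earlierTo.app c φ = (Face.top Face).1 ⟨c, Face.earlierTo.app c φ⟩) :
    φ = (Face.top Face).1 ⟨nextStage.op.obj c, φ⟩ := by
  obtain ⟨_, r, rfl⟩ := φ
  have h₁ := congrArg (fun s => (ULift.down (Subtype.val s)).arrows (𝟙 c.unop)) h
  have h₂ : Itv.map (𝟙 c.unop ≫ nextStageHom c.unop).op r = ULift.up (⊤ : FreeDM _) :=
    h₁.mpr trivial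
  have h₃ : r = ULift.up (⊤ : FreeDM c.unop.1.names) := by
    refine Eq.trans ?_ h₂
    exact congrArg ULift.up (FreeDM.lift_of_self r.down).symm
  subst h₃
  exact Subtype.ext (Itv.eqOne_top _)

/-! ### Transposing paths and faces -/

variable (σ : Γ ⟶ Δ.later)

/-- The transpose of `σ`, applied pointwise to paths. -/
def pathMap : (pathCtx Γ).earlier ⟶ pathCtx Δ :=
  Ctx.pair (A := pathTy Δ) { app := fun _ => ↾fun _ => PUnit.unit }
    -- The path lives at `(I, n + 1)` and is evaluated only at shifted stages. The same `r` serves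
    -- at both stages because `dM(I)` does not mention `n`.
    ⟨fun j => ⟨fun k h r => (Ctx.transpose σ).app k.1
        (j.2.2.1 ⟨nextStage.op.obj k.1, PUnit.unit⟩ ⟨nextStage.op.map h.1, rfl⟩ r),
      fun k l h g r => by
        refine (NatTrans.naturality_apply (Ctx.transpose σ) g.1 _).symm.trans ?_
        exact congrArg ((Ctx.transpose σ).app l.1)
          (j.2.2.2 ⟨nextStage.op.obj k.1, PUnit.unit⟩ ⟨nextStage.op.obj l.1, PUnit.unit⟩
            ⟨nextStage.op.map h.1, rfl⟩ ⟨nextStage.op.map g.1, rfl⟩ r)⟩, by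
      intro j j' f
      refine Subtype.ext (funext fun k => funext fun h => funext fun r => ?_)
      have e := (Ctx.var (pathTy Γ)).2 (Ctx.nextEltHom f)
      exact congrArg (fun q : (pathTy Γ).obj ⟨nextStage.op.obj j'.1, PUnit.unit⟩ =>
        (Ctx.transpose σ).app k.1
          (q.1 ⟨nextStage.op.obj k.1, PUnit.unit⟩ ⟨nextStage.op.map h.1, rfl⟩ r)) e⟩

/-- Paths under the transpose of `σ`, with the restriction of faces. -/
def faceMap : (faceCtx Γ).earlier ⟶ faceCtx Δ :=
  Ctx.pair (A := Face.asTy (pathCtx Δ)) (Ctx.earlierMap (Ctx.wk _) ≫ pathMap σ)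
    -- Faces are sieves, on `(I, n + 1)` and on `(I, n)` respectively, so unlike interval elements
    -- they have to be restricted.
    ⟨fun j => Face.earlierTo.app j.1 (Ctx.nextElt j).2.2, fun {j k} g => by
      refine (NatTrans.naturality_apply Face.earlierTo g.1 _).symm.trans ?_
      exact congrArg (Face.earlierTo.app k.1)
        ((Ctx.var (Face.asTy (pathCtx Γ))).2 (Ctx.nextEltHom g))⟩

/-- Needed to evaluate `u` at stage `n + 1` when only the restricted face is known to hold. -/
theorem eq_top_of_faceMap {j : (faceCtx Γ).earlier.Elements}
    (p : ((Face.ty (faceVar Δ)).subst (faceMap σ)).obj j) :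
    (faceVar Γ).1 (Ctx.nextElt j) = (Face.top (faceCtx Γ)).1 (Ctx.nextElt j) :=
  Face.eq_top_of_earlierTo j.2.2 p.down.down

theorem faceMap_eq_top {j : (faceCtx Γ).earlier.Elements}
    (p : (Face.ty (faceVar Γ)).obj (Ctx.nextElt j)) :
    ((faceVar Δ).subst (faceMap σ)).1 j = ((Face.top (faceCtx Δ)).subst (faceMap σ)).1 j := by
  refine (congrArg (Face.earlierTo.app j.1) p.down.down).trans ?_
  exact (Face.top (faceCtx Γ)).2 (j := Ctx.nextElt j)
    (j' := ⟨j.1, (faceCtx Γ).map (nextStageHom j.1.unop).op j.2⟩)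
    ⟨(nextStageHom j.1.unop).op, rfl⟩

/-! ### Transposing systems -/

variable (A : Ty Δ)

/-- The type `▷ A` over `▷ Δ`, pulled back along `σ`. -/
abbrev Ty.laterAlong : Ty Γ := A.later.subst σ

/-- The substitution of `σ` in paths and faces, in the context `γ, φ, u`. -/
abbrev sysFaceMap : (sysCtx (A.laterAlong σ)).earlier ⟶ faceCtx Δ :=
  Ctx.earlierMap (Ctx.wk _) ≫ faceMap σ

theorem Ctx.ext_id_ext {S : Type} [SmallCategory S] {Γ Y : Ctx.{u} S} {A : Ty Γ} {t s : Tm A}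
    {τ : Y ⟶ Γ} {c : Sᵒᵖ} {x y : (Y.ext ((Ty.id t s).subst τ)).obj c} (h : x.1 = y.1) :
    x = y := by
  obtain ⟨x, p⟩ := x
  obtain ⟨y, q⟩ := y
  dsimp only at h
  subst h
  exact congrArg (Sigma.mk x) (Ty.id_ext p q)

/-- The value `u(i)` in context `γ, φ, u, i : 𝕀, p : [φ]`. -/
def sysVal (B : Ty Γ) :=
  let p := Ctx.wk ((Face.ty (sysFace B)).subst (Ctx.wk (Itv.asTy (sysCtx B))))
  let q := p ≫ Ctx.wk _
  let ui := Tm.app (A := Itv.asTy (faceCtx Γ)) (B := Ty.pi (itvFace Γ) (sysFibre B))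
    (σ := q ≫ Ctx.wk (sysTy B)) ((Ctx.var (sysTy B)).subst q) ((Ctx.var (Itv.asTy _)).subst p)
  Tm.app (A := itvFace Γ) (B := sysFibre B) ui
    (Ctx.var ((Face.ty (sysFace B)).subst (Ctx.wk (Itv.asTy (sysCtx B)))))

set_option maxHeartbeats 1000000 in
/-- The transpose of the value `u(i)`. -/
def sysValTm : Tm ((sysFibre A).subst
    (Ctx.under (Ctx.under (sysFaceMap σ A) (Itv.asTy (faceCtx Δ))) (itvFace Δ))) :=
  -- The value at `(I, n)` is that of `u` at `(I, n + 1)`, an element of the same fibre by the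
  -- definition of `▷A`.
  ⟨fun j => (sysVal (A.laterAlong σ)).1 ⟨nextStage.op.obj j.1, ⟨⟨j.2.1.1, j.2.1.2⟩,
      ⟨⟨eq_top_of_faceMap σ (j := ⟨j.1, j.2.1.1.1⟩) j.2.2⟩⟩⟩⟩, fun {j k} g =>
    (sysVal (A.laterAlong σ)).2
      (j := ⟨nextStage.op.obj j.1, ⟨⟨j.2.1.1, j.2.1.2⟩,
        ⟨⟨eq_top_of_faceMap σ (j := ⟨j.1, j.2.1.1.1⟩) j.2.2⟩⟩⟩⟩)
      (j' := ⟨nextStage.op.obj k.1, ⟨⟨k.2.1.1, k.2.1.2⟩,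
        ⟨⟨eq_top_of_faceMap σ (j := ⟨k.1, k.2.1.1.1⟩) k.2.2⟩⟩⟩⟩)
      ⟨nextStage.op.map g.1, by
        have e := congrArg Sigma.fst g.2
        exact Ctx.ext_id_ext e⟩⟩

/-- The transpose of the family `u`. -/
def sysTm : Tm ((sysTy A).subst (sysFaceMap σ A)) :=
  Tm.lamAlong (A := Itv.asTy (faceCtx Δ)) (B := Ty.pi (itvFace Δ) (sysFibre A))
    (Tm.lamAlong (A := itvFace Δ) (B := sysFibre A) (sysValTm σ A))

/-- Two uses of the β-rule, for the interval variable and for the proof of the face. -/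
theorem sysTm_app (j : (sysCtx (A.laterAlong σ)).earlier.Elements)
    (r : (Itv.asTy (faceCtx Δ)).obj ((CategoryOfElements.map (sysFaceMap σ A)).obj j))
    (p : (itvFace Δ).obj (Ctx.elt ((CategoryOfElements.map (sysFaceMap σ A)).obj j) r)) :
    (((sysTm σ A).1 j).1 ((CategoryOfElements.map (sysFaceMap σ A)).obj j) (𝟙 _) r).1
        (Ctx.elt ((CategoryOfElements.map (sysFaceMap σ A)).obj j) r) (𝟙 _) p =
      (sysVal (A.laterAlong σ)).1 ⟨nextStage.op.obj j.1, ⟨⟨j.2, r⟩,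
         ⟨⟨eq_top_of_faceMap σ (j := ⟨j.1, j.2.1⟩) p⟩⟩⟩⟩ := by
  have e := Tm.lamAlong_app (A := Itv.asTy (faceCtx Δ)) (B := Ty.pi (itvFace Δ) (sysFibre A))
    (Tm.lamAlong (A := itvFace Δ) (B := sysFibre A) (sysValTm σ A)) j r
  refine (congrArg (fun q : (Ty.pi (itvFace Δ) (sysFibre A)).obj
      (Ctx.elt ((CategoryOfElements.map (sysFaceMap σ A)).obj j) r) =>
    q.1 (Ctx.elt ((CategoryOfElements.map (sysFaceMap σ A)).obj j) r) (𝟙 _) p) e).trans ?_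
  exact Tm.lamAlong_app (A := itvFace Δ) (B := sysFibre A) (sysValTm σ A)
    (Ctx.elt (A := (Itv.asTy (faceCtx Δ)).subst (sysFaceMap σ A)) j r) p

/-- The transpose of `σ` in the context `γ, φ, u`. -/
def sysMap : (sysCtx (A.laterAlong σ)).earlier ⟶ sysCtx A :=
  Ctx.pair (sysFaceMap σ A) (sysTm σ A)

/-- The case `r = 0` of `sysTm_app`: the endpoint is the same element at both stages. -/
theorem sysAt_sysMap_zero (j : (sysCtx (A.laterAlong σ)).earlier.Elements)
    (p : ((Face.ty (sysFace A)).subst (sysMap σ A)).obj j)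
    (q : (Face.ty (sysFace (A.laterAlong σ))).obj (Ctx.nextElt j)) :
    (sysAt A (Itv.zero _)).1 (Ctx.elt ((CategoryOfElements.map (sysMap σ A)).obj j) p) =
      (sysAt (A.laterAlong σ) (Itv.zero _)).1 (Ctx.elt (Ctx.nextElt j) q) := by
  have e := sysTm_app σ A j ((Itv.zero (sysCtx (A.laterAlong σ))).1 (Ctx.nextElt j)) p
  exact e

theorem sysAt_sysMap_one (j : (sysCtx (A.laterAlong σ)).earlier.Elements)
    (p : ((Face.ty (sysFace A)).subst (sysMap σ A)).obj j)
    (q : (Face.ty (sysFace (A.laterAlong σ))).obj (Ctx.nextElt j)) :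
    (sysAt A (Itv.one _)).1 (Ctx.elt ((CategoryOfElements.map (sysMap σ A)).obj j) p) =
      (sysAt (A.laterAlong σ) (Itv.one _)).1 (Ctx.elt (Ctx.nextElt j) q) := by
  have e := sysTm_app σ A j ((Itv.one (sysCtx (A.laterAlong σ))).1 (Ctx.nextElt j)) p
  exact e

end

/-! ### Composition for later types -/

/-- The type `A(γ(0))[φ ↦ u(0)]`. -/
abbrev baseTy {Γ : Ctx.{u} CubeOmega} (A : Ty Γ) : Ty (sysCtx A) :=
  (fibreAt A (Itv.zero _)).extent (sysFace A) (sysAt A (Itv.zero _))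

/-- The type `A(γ(1))[φ ↦ u(1)]`. -/
abbrev lidTy {Γ : Ctx.{u} CubeOmega} (A : Ty Γ) : Ty (sysCtx A) :=
  (fibreAt A (Itv.one _)).extent (sysFace A) (sysAt A (Itv.one _))

/-- The type of compositions, as an iterated dependent product. -/
theorem CompTy_eq {Γ : Ctx.{u} CubeOmega} (A : Ty Γ) :
    CompTy A = Ty.pi (pathTy Γ) (Ty.pi (Face.asTy (pathCtx Γ)) (Ty.pi (sysTy A)
      (Ty.pi (baseTy A) ((lidTy A).subst (Ctx.wk (baseTy A)))))) := rfl

/-- The term of `A(γ(1))[φ ↦ u(1)]` in context `γ, φ, u, a` given by a composition structure. -/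
def lidOfComp {Γ : Ctx.{u} CubeOmega} {A : Ty Γ} (cA : Tm (CompTy A)) :
    Tm ((lidTy A).subst (Ctx.wk (baseTy A))) :=
  Tm.unlam (Tm.unlam (Tm.unlam (Tm.unlam (Eq.mp (congrArg (fun T => Tm T) (CompTy_eq A)) cA))))

/-- The composition structure given by a term of `A(γ(1))[φ ↦ u(1)]` in context `γ, φ, u, a`. -/
def compOfLid {Γ : Ctx.{u} CubeOmega} {A : Ty Γ}
    (t : Tm ((lidTy A).subst (Ctx.wk (baseTy A)))) : Tm (CompTy A) :=
  Eq.mpr (congrArg (fun T => Tm T) (CompTy_eq A)) (Tm.lam (Tm.lam (Tm.lam (Tm.lam t))))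

section

variable {Γ Δ Y : Ctx.{u} CubeOmega} (σ : Γ ⟶ Δ.later) (A : Ty Δ)

theorem fibreAt_zero_map {j k : (sysCtx (A.laterAlong σ)).earlier.Elements} (g : j ⟶ k)
    (a : (fibreAt (A.laterAlong σ) (Itv.zero _)).obj (Ctx.nextElt j)) :
    (fibreAt A (Itv.zero _)).map ((CategoryOfElements.map (sysMap σ A)).map g) a =
      (fibreAt (A.laterAlong σ) (Itv.zero _)).map (Ctx.nextEltHom g) a := rfl

variable {A} {τ : Y ⟶ sysCtx (A.laterAlong σ)}

/-- The transpose of a term of the fibre over `γ(0)` of a later type. -/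
def Tm.transposeFibre (a : Tm ((fibreAt (A.laterAlong σ) (Itv.zero _)).subst τ)) :
    Tm ((fibreAt A (Itv.zero _)).subst (Ctx.earlierMap τ ≫ sysMap σ A)) :=
  ⟨fun j => a.1 (Ctx.nextElt j), fun g =>
    (fibreAt_zero_map σ A ((CategoryOfElements.map (Ctx.earlierMap τ)).map g) _).trans
      (a.2 (Ctx.nextEltHom g))⟩

/-- The term of the fibre over `γ(1)` of a later type whose transpose is `a`. -/
def Tm.laterFibre (a : Tm ((fibreAt A (Itv.one _)).subst (Ctx.earlierMap τ ≫ sysMap σ A))) :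
    Tm ((fibreAt (A.laterAlong σ) (Itv.one _)).subst τ) :=
  ⟨fun j => match j with
    -- At stage `0` there is no earlier stage to consult, but the fibre of `▷A` is a point.
    | ⟨⟨(_, 0)⟩, _⟩ => PUnit.unit
    | ⟨⟨(I, n + 1)⟩, y⟩ => a.1 ⟨⟨(I, n)⟩, y⟩, by
    rintro ⟨⟨⟨I, n⟩⟩, x⟩ ⟨⟨⟨J, m⟩⟩, y⟩ ⟨f, h⟩
    have hle : m ≤ n := leOfHom f.unop.2
    cases m with
    | zero => rfl
    | succ m =>
      cases n with
      | zero => omega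
      | succ n =>
        exact a.2 (j := ⟨⟨(I, n)⟩, x⟩) (j' := ⟨⟨(J, m)⟩, y⟩)
          ⟨Quiver.Hom.op (Prod.mkHom f.unop.1 (homOfLE (Nat.le_of_succ_le_succ hle))), h⟩⟩

/-- Equations in `▷A` are automatic at stage `0`, so only the stages `n + 1` need a check, and there
they are equations in `A`. -/
theorem Tm.laterFibre_eq {a : Tm ((fibreAt A (Itv.one _)).subst (Ctx.earlierMap τ ≫ sysMap σ A))}
    {P : Y.Elements → Type u}
    (b : ∀ j, P j → ((fibreAt (A.laterAlong σ) (Itv.one _)).subst τ).obj j)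
    (h : ∀ (k : Y.earlier.Elements) (p : P (Ctx.nextElt k)), a.1 k = b (Ctx.nextElt k) p)
    (j : Y.Elements) (p : P j) : (Tm.laterFibre σ a).1 j = b j p := by
  obtain ⟨⟨⟨I, n⟩⟩, y⟩ := j
  cases n with
  | zero => rfl
  | succ n => exact h ⟨⟨(I, n)⟩, y⟩ p

variable (A)

/-- The transpose of the variable `a` in context `γ, φ, u, a`. -/
def baseTm : Tm ((baseTy A).subst
    (Ctx.earlierMap (Ctx.wk (baseTy (A.laterAlong σ))) ≫ sysMap σ A)) :=
  Tm.extentMk (A := fibreAt A (Itv.zero _)) (φ := sysFace A) (v := sysAt A (Itv.zero _))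
    (τ := Ctx.earlierMap (Ctx.wk (baseTy (A.laterAlong σ))) ≫ sysMap σ A)
    (Tm.transposeFibre σ (Tm.extentFst (A := fibreAt (A.laterAlong σ) (Itv.zero _))
      (φ := sysFace (A.laterAlong σ)) (v := sysAt (A.laterAlong σ) (Itv.zero _))
      (τ := Ctx.wk (baseTy (A.laterAlong σ))) (Ctx.var (baseTy (A.laterAlong σ)))))
    fun j p => by
      -- The boundary condition on `a` is available at stage `n + 1`, so the face is first lifted
      -- there.
      have q := eq_top_of_faceMap σ (j := ⟨j.1, j.2.1.1⟩) p
      have e := Tm.extentFst_eq (A := fibreAt (A.laterAlong σ) (Itv.zero _))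
        (φ := sysFace (A.laterAlong σ)) (v := sysAt (A.laterAlong σ) (Itv.zero _))
        (τ := Ctx.wk (baseTy (A.laterAlong σ))) (Ctx.var (baseTy (A.laterAlong σ)))
        (Ctx.nextElt j) ⟨⟨q⟩⟩
      exact e.trans (sysAt_sysMap_zero σ A ⟨j.1, j.2.1⟩ p ⟨⟨q⟩⟩).symm

variable {A}

/-- Substitution for a variable on which the type does not depend. -/
def Tm.instantiate {S : Type} [SmallCategory S] {Γ Δ : Ctx.{u} S} {A B : Ty Δ} {σ : Γ ⟶ Δ}
    (t : Tm (B.subst (Ctx.wk A))) (a : Tm (A.subst σ)) : Tm (B.subst σ) :=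
  t.subst (Ctx.pair σ a)

/-- The term of `A(γ(1))[φ ↦ u(1)]` given by composition with the transposed data. -/
def transposedLid (cA : Tm (CompTy A)) :
    Tm ((lidTy A).subst (Ctx.earlierMap (Ctx.wk (baseTy (A.laterAlong σ))) ≫ sysMap σ A)) :=
  Tm.instantiate (lidOfComp cA) (baseTm σ A)

/-- The composition structure on the later type. -/
def laterComp (cA : Tm (CompTy A)) : Tm (CompTy (A.laterAlong σ)) :=
  compOfLid (Tm.extentMk (A := fibreAt (A.laterAlong σ) (Itv.one _))
    (φ := sysFace (A.laterAlong σ)) (v := sysAt (A.laterAlong σ) (Itv.one _))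
    (τ := Ctx.wk (baseTy (A.laterAlong σ)))
    (Tm.laterFibre σ (Tm.extentFst (A := fibreAt A (Itv.one _)) (φ := sysFace A)
      (v := sysAt A (Itv.one _))
      (τ := Ctx.earlierMap (Ctx.wk (baseTy (A.laterAlong σ))) ≫ sysMap σ A) (transposedLid σ cA)))
    (Tm.laterFibre_eq σ (τ := Ctx.wk (baseTy (A.laterAlong σ)))
      (P := fun j : ((sysCtx (A.laterAlong σ)).ext (baseTy (A.laterAlong σ))).Elements =>
        (Face.ty (sysFace (A.laterAlong σ))).obj ⟨j.1, j.2.1⟩)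
      (fun j p => (sysAt (A.laterAlong σ) (Itv.one _)).1
        (Ctx.elt (A := Face.ty (sysFace (A.laterAlong σ))) ⟨j.1, j.2.1⟩ p))
      (fun k q => by
        -- Here the face is given at stage `n + 1` and is restricted, since the composite in `A`
        -- satisfies its boundary condition at stage `n`.
        have p := faceMap_eq_top σ (j := ⟨k.1, k.2.1.1⟩) q
        have e := Tm.extentFst_eq (A := fibreAt A (Itv.one _)) (φ := sysFace A)
          (v := sysAt A (Itv.one _))
          (τ := Ctx.earlierMap (Ctx.wk (baseTy (A.laterAlong σ))) ≫ sysMap σ A)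
          (transposedLid σ cA) k ⟨⟨p⟩⟩
        exact e.trans (sysAt_sysMap_one σ A ⟨k.1, k.2.1⟩ ⟨⟨p⟩⟩ q))))

end

end GCTT

open GCTT
theorem mainTheorem3 {Γ Δ : Ctx.{u} CubeOmega} {σ : Γ ⟶ Δ.later} (ξ : DelayedSubst Γ Δ σ)
    (A : Ty Δ) (cA : Tm (CompTy A)) : Nonempty (Tm (CompTy (ξ.later A))) := by
  -- Only the interpretation `σ` of `ξ` matters, so no induction on delayed substitutions is needed.
  have h : ξ.later A = A.laterAlong σ := rfl
  rw [h]
  exact ⟨laterComp σ cA⟩
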